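/- Let $d\ge 0$ be an integer and let $A\in\mathbb{Q}^{d\times d}$ be a matrix with rational entries (not assumed invertible). For a set $S\subset\mathbb{Q}^d$ put $$S[A]:=\bigcup_{\ell=1}^{\infty}\bigl(S+AS+\dots+A^{\ell-1}S\bigr)=\Bigl\{\sum_{i=0}^{\ell-1}A^i\mathbf{s}_i : \ell\ge 1,\ \mathbf{s}_0,\dots,\mathbf{s}_{\ell-1}\in S\Bigr\},$$ so that in particular $\mathbb{Z}^d[A]=\bigcup_{\ell\ge1}(\mathbb{Z}^d+A\mathbb{Z}^d+\dots+A^{\ell-1}\mathbb{Z}^d)$. For a finite set $\mathcal{D}\subset\mathbb{Z}^d[A]$, the digit system $(A,\mathcal{D})$ is said to have the finiteness property in $\mathbb{Z}^d[A]$ if $\mathbb{Z}^d[A]=\mathcal{D}[A]$. Then there exists a finite digit set $\mathcal{D}\subset\mathbb{Z}^d[A]$ such that $(A,\mathcal{D})$ has the finiteness property in $\mathbb{Z}^d[A]$ if and only if $A$ has no eigenvalue $\lambda\in\mathbb{C}$ with $|\lambda|<1$. Moreover, if $A$ has no such eigenvalue, then $\mathcal{D}$ can even be chosen as a finite subset of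 $\mathbb{Z}^d$. -/

import Mathlib

namespace MatrixDigit

/-- For a set `S` of vectors, the set `S[A]` of all finite sums
`s₀ + A s₁ + ⋯ + A ^ (ℓ - 1) s_{ℓ-1}` with `ℓ ≥ 1` and all `sᵢ ∈ S`. -/
def radixSet {d : ℕ} (A : Matrix (Fin d) (Fin d) ℚ) (S : Set (Fin d → ℚ)) : Set (Fin d → ℚ) :=
  {x | ∃ l : ℕ, 1 ≤ l ∧ ∃ s : Fin l → (Fin d → ℚ),
    (∀ i, s i ∈ S) ∧ x = ∑ i : Fin l, (A ^ (i : ℕ)).mulVec (s i)}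

/-- The lattice `ℤ^d`, as a set of vectors in `ℚ^d`. -/
def intVectors (d : ℕ) : Set (Fin d → ℚ) :=
  Set.range fun (z : Fin d → ℤ) (i : Fin d) => (z i : ℚ)

/-- The module `ℤ^d[A]`. -/
def intModule {d : ℕ} (A : Matrix (Fin d) (Fin d) ℚ) : Set (Fin d → ℚ) :=
  radixSet A (intVectors d)

/-- `(A, D)` is a digit system in `ℤ^d[A]`: the digits form a finite subset of `ℤ^d[A]`. -/
def IsDigitSystem {d : ℕ} (A : Matrix (Fin d) (Fin d) ℚ) (D : Set (Fin d → ℚ)) : Prop :=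
  D.Finite ∧ D ⊆ intModule A

/-- The finiteness property `ℤ^d[A] = D[A]`. -/
def HasFinitenessProperty {d : ℕ} (A : Matrix (Fin d) (Fin d) ℚ) (D : Set (Fin d → ℚ)) : Prop :=
  intModule A = radixSet A D

/-- `lam` is a complex eigenvalue of the rational matrix `A`. -/
def IsComplexEigenvalue {d : ℕ} (A : Matrix (Fin d) (Fin d) ℚ) (lam : ℂ) : Prop :=
  Module.End.HasEigenvalue (Matrix.toLin' (A.map (algebraMap ℚ ℂ))) lam

end MatrixDigit

namespace MatrixDigit

open Polynomial

/-! For sufficiency, clear denominators in the characteristic polynomial to get an integer `p` with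
`p(A) = 0` and all roots of norm at least 1. Vectors of `ℤ^d[A]` have the form `∑ fⱼ(A) eⱼ` with
integer `fⱼ`, so it suffices to replace each `fⱼ` modulo `p` by a polynomial of bounded height and
arbitrary degree; a box in `ℤ^d` then serves as digit set. Such replacement for two polynomials
gives it for their product, so `p` may be taken irreducible, hence constant or with distinct roots.
In the latter case repeatedly write `q ≡ d + X q'` with `d` bounded and near a multiple of `q`, so
that the values of `q'` at the roots shrink (`exists_norm_reduction`). For necessity, a left
eigenvector for `|λ| < 1` is bounded on `D[A]` by a geometric series, but unbounded on `ℤ^d`. -/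

/-- All coefficients of `f` have absolute value at most `C`. -/
def HeightLE (C : ℤ) (f : ℤ[X]) : Prop := ∀ i, |f.coeff i| ≤ C

/-- Every integer polynomial is congruent modulo `p` to one of bounded height. -/
def HasBoundedRepresentatives (p : ℤ[X]) : Prop :=
  ∃ C : ℤ, ∀ q : ℤ[X], ∃ r : ℤ[X], p ∣ q - r ∧ HeightLE C r

/-! ### Height under polynomial arithmetic -/

namespace HeightLE

theorem nonneg {C : ℤ} {f : ℤ[X]} (h : HeightLE C f) : 0 ≤ C :=
  (abs_nonneg _).trans (h 0)

theorem zero {C : ℤ} (hC : 0 ≤ C) : HeightLE C 0 := fun i => by simpa using hC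

theorem add {C C' : ℤ} {f g : ℤ[X]} (hf : HeightLE C f) (hg : HeightLE C' g) :
    HeightLE (C + C') (f + g) := fun i => by
  rw [coeff_add]
  exact (abs_add_le _ _).trans (add_le_add (hf i) (hg i))

theorem X_pow_mul {C : ℤ} {f : ℤ[X]} (hf : HeightLE C f) (m : ℕ) :
    HeightLE C (X ^ m * f) := fun i => by
  rw [coeff_X_pow_mul']
  split_ifs
  · exact hf _
  · simpa using hf.nonneg

theorem C_add_X_mul {C c : ℤ} {f : ℤ[X]} (hc : |c| ≤ C) (hf : HeightLE C f) :
    HeightLE C (Polynomial.C c + X * f) := by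
  intro i
  cases i with
  | zero => simpa using hc
  | succ i => simpa only [coeff_add, coeff_C_succ, coeff_X_mul, zero_add] using hf i

theorem const {C c : ℤ} (hc : |c| ≤ C) : HeightLE C (Polynomial.C c) := by
  simpa using C_add_X_mul hc (zero ((abs_nonneg c).trans hc))

theorem sum {ι : Type*} {C : ℤ} (s : Finset ι) {f : ι → ℤ[X]} (hf : ∀ i ∈ s, HeightLE C (f i)) :
    HeightLE (s.card * C) (∑ i ∈ s, f i) := fun k => by
  rw [finsetSum_coeff]
  refine (Finset.abs_sum_le_sum_abs _ _).trans ((Finset.sum_le_card_nsmul _ _ C ?_).trans ?_)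
  · exact fun i hi => hf i hi k
  · simp

theorem exists_mul (p : ℤ[X]) (C : ℤ) : ∃ K : ℤ, ∀ f, HeightLE C f → HeightLE K (p * f) := by
  induction p using Polynomial.induction_on' with
  | add p q hp hq =>
    obtain ⟨K, hK⟩ := hp
    obtain ⟨L, hL⟩ := hq
    exact ⟨K + L, fun f hf => by rw [add_mul]; exact (hK f hf).add (hL f hf)⟩
  | monomial n a =>
    refine ⟨|a| * C, fun f hf => ?_⟩
    rw [← C_mul_X_pow_eq_monomial, mul_assoc]
    intro i
    rw [coeff_C_mul, abs_mul]
    exact mul_le_mul_of_nonneg_left (hf.X_pow_mul n i) (abs_nonneg a)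

end HeightLE

/-! ### Bounded representatives modulo a polynomial -/

namespace HasBoundedRepresentatives

/-- Reduce modulo `p`, then reduce the quotient modulo `q`; multiplication by the fixed `p` keeps
heights bounded. This is how repeated roots are handled. -/
theorem mul {p q : ℤ[X]} (hp : HasBoundedRepresentatives p) (hq : HasBoundedRepresentatives q) :
    HasBoundedRepresentatives (p * q) := by
  obtain ⟨C, hC⟩ := hp
  obtain ⟨C', hC'⟩ := hq
  obtain ⟨K, hK⟩ := HeightLE.exists_mul p C'
  refine ⟨C + K, fun f => ?_⟩
  obtain ⟨r, ⟨g, hg⟩, hr⟩ := hC f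
  obtain ⟨s, ⟨h, hh⟩, hs⟩ := hC' g
  exact ⟨r + p * s, ⟨h, by linear_combination hg + p * hh⟩, hr.add (hK s hs)⟩

theorem of_isUnit {p : ℤ[X]} (hp : IsUnit p) : HasBoundedRepresentatives p :=
  ⟨0, fun _ => ⟨0, hp.dvd, HeightLE.zero le_rfl⟩⟩

theorem C_of_ne_zero {a : ℤ} (ha : a ≠ 0) : HasBoundedRepresentatives (C a) := by
  refine ⟨|a|, fun q => ?_⟩
  refine ⟨∑ i ∈ q.support, monomial i (q.coeff i % a), ?_, fun i => ?_⟩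
  · rw [C_dvd_iff_dvd_coeff]
    intro i
    by_cases h : q.coeff i = 0
    · simp [coeff_monomial, h]
    · simpa [coeff_monomial, h] using Int.dvd_self_sub_emod
  · by_cases h : q.coeff i = 0
    · simp [coeff_monomial, h]
    · simpa [coeff_monomial, h, abs_of_nonneg (Int.emod_nonneg _ ha)] using
        (Int.emod_lt_abs _ ha).le

/-- Division with remainder by `X` modulo `p`. -/
theorem exists_shift {p q d : ℤ[X]} (h : p.coeff 0 ∣ (q - d).coeff 0) :
    ∃ q' : ℤ[X], p ∣ q - (d + X * q') ∧
      q'.natDegree ≤ max (max q.natDegree d.natDegree) p.natDegree - 1 := by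
  obtain ⟨k, hk⟩ := h
  refine ⟨divX (q - d - C k * p), ⟨C k, ?_⟩, ?_⟩
  · have h1 := divX_mul_X_add (q - d - C k * p)
    have h2 : (q - d - C k * p).coeff 0 = 0 := by
      rw [coeff_sub, hk, coeff_C_mul, mul_comm, sub_self]
    rw [h2, C_0] at h1
    linear_combination -h1
  · rw [natDegree_divX_eq_natDegree_tsub_one]
    refine Nat.sub_le_sub_right ((natDegree_sub_le _ _).trans (max_le_max (natDegree_sub_le _ _) ?_)) 1
    exact natDegree_C_mul_le _ _

/-- Splitting off constant terms modulo `p.coeff 0` lowers the degree until it drops below that of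
`p`. -/
theorem exists_degree_reduction {p : ℤ[X]} (h0 : p.coeff 0 ≠ 0) (hn : 0 < p.natDegree) :
    ∀ (N : ℕ) (q : ℤ[X]), q.natDegree ≤ N → ∃ (f g : ℤ[X]) (m : ℕ),
      p ∣ q - (f + X ^ m * g) ∧ HeightLE |p.coeff 0| f ∧ g.natDegree < p.natDegree := by
  intro N
  induction N with
  | zero =>
    exact fun q hq => ⟨0, q, 0, by simp, HeightLE.zero (abs_nonneg _), by omega⟩
  | succ N ih =>
    intro q hq
    by_cases hlt : q.natDegree < p.natDegree
    · exact ⟨0, q, 0, by simp, HeightLE.zero (abs_nonneg _), hlt⟩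
    obtain ⟨q', ⟨u, hu⟩, hq'⟩ := exists_shift (p := p) (q := q)
      (d := C (q.coeff 0 % p.coeff 0)) (by simpa using Int.dvd_self_sub_emod)
    rw [natDegree_C] at hq'
    obtain ⟨f, g, m, ⟨v, hv⟩, hf, hg⟩ := ih q' (by omega)
    refine ⟨C (q.coeff 0 % p.coeff 0) + X * f, g, m + 1, ⟨u + X * v, ?_⟩,
      HeightLE.C_add_X_mul ?_ hf, hg⟩
    · linear_combination hu + X * hv
    · rw [abs_of_nonneg (Int.emod_nonneg _ h0)]
      exact (Int.emod_lt_abs _ h0).le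

/-- A polynomial of degree less than the number of points of `s` has its coefficients controlled
by its values on `s`. -/
theorem exists_coeff_le (s : Finset ℂ) {n : ℕ} (hs : n ≤ s.card) :
    ∃ κ : ℝ, 0 ≤ κ ∧ ∀ q : ℤ[X], q.natDegree < n → ∀ N : ℝ, 0 ≤ N →
      (∀ z ∈ s, ‖aeval z q‖ ≤ N) → ∀ j, |(q.coeff j : ℝ)| ≤ κ * N := by
  let E : (Fin n → ℝ) →ₗ[ℝ] (s → ℂ) :=
    { toFun := fun v z => ∑ j, (v j : ℂ) * (z : ℂ) ^ (j : ℕ)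
      map_add' := fun v w => by ext z; simp [add_mul, Finset.sum_add_distrib]
      map_smul' := fun c v => by ext z; simp [mul_assoc, Finset.mul_sum] }
  -- Vandermonde: a nonzero polynomial of degree below `n` cannot vanish at `n` points. Injectivity
  -- in finite dimension then gives the bound `κ`.
  have hE : LinearMap.ker E = ⊥ := by
    rw [LinearMap.ker_eq_bot']
    intro v hv
    let P : ℂ[X] := ∑ j : Fin n, C (v j : ℂ) * X ^ (j : ℕ)
    have hcoeff : ∀ j : Fin n, P.coeff j = v j := fun j => by
      simp [P, coeff_X_pow, Fin.val_inj]
    have hP : P = 0 := by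
      by_contra hP
      refine hP (eq_zero_of_natDegree_lt_card_of_eval_eq_zero' P s (fun z hz => ?_) ?_)
      · simpa [P, E, eval_finsetSum] using congrFun hv ⟨z, hz⟩
      · refine lt_of_lt_of_le ?_ hs
        rw [natDegree_lt_iff_degree_lt hP]
        exact degree_sum_fin_lt _
    ext j
    have := hcoeff j
    rw [hP, coeff_zero] at this
    exact_mod_cast this.symm
  obtain ⟨κ, -, hκ⟩ := E.exists_antilipschitzWith hE
  refine ⟨κ, κ.2, fun q hq N hN h j => ?_⟩
  by_cases hj : j < n
  · let v : Fin n → ℝ := fun i => q.coeff i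
    have h1 : ‖v‖ ≤ κ * ‖E v‖ := by
      simpa [dist_eq_norm] using hκ.le_mul_dist v 0
    have h2 : ‖E v‖ ≤ N := by
      refine (pi_norm_le_iff_of_nonneg hN).2 fun z => ?_
      have : E v z = aeval (z : ℂ) q := by
        rw [aeval_eq_sum_range' hq, Finset.sum_range]
        simp [E, v]
      rw [this]
      exact h z z.2
    calc |(q.coeff j : ℝ)| = ‖v ⟨j, hj⟩‖ := rfl
      _ ≤ ‖v‖ := norm_le_pi_norm v _
      _ ≤ κ * N := h1.trans (mul_le_mul_of_nonneg_left h2 κ.2)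
  · rw [coeff_eq_zero_of_natDegree_lt (by omega)]
    simpa using mul_nonneg κ.2 hN

theorem exists_norm_reduction {p : ℤ[X]} (h0 : p.coeff 0 ≠ 0) (hn : 0 < p.natDegree)
    (s : Finset ℂ) (hs : p.natDegree ≤ s.card) (hroot : ∀ z ∈ s, aeval z p = 0)
    (hnorm : ∀ z ∈ s, 1 ≤ ‖z‖) :
    ∃ C : ℤ, ∀ q : ℤ[X], q.natDegree < p.natDegree →
      ∃ r : ℤ[X], p ∣ q - r ∧ HeightLE C r := by
  obtain ⟨κ, hκ0, hκ⟩ := exists_coeff_le s hs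
  set n := p.natDegree with hn_def
  set a := p.coeff 0 with ha_def
  have ha : (a : ℝ) ≠ 0 := by exact_mod_cast h0
  -- `B` bounds, at every point of `s`, polynomials of degree below `n` with coefficients at most
  -- `|a|`.
  obtain ⟨B, hB0, hB⟩ : ∃ B : ℝ, 0 ≤ B ∧
      ∀ z ∈ s, ∑ j ∈ Finset.range n, |(a : ℝ)| * ‖z‖ ^ j ≤ B :=
    ⟨∑ z ∈ s, ∑ j ∈ Finset.range n, |(a : ℝ)| * ‖z‖ ^ j, by positivity, fun z hz =>
      Finset.single_le_sum (f := fun z : ℂ => ∑ j ∈ Finset.range n, |(a : ℝ)| * ‖z‖ ^ j)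
        (fun _ _ => by positivity) hz⟩
  set H : ℤ := ⌈κ * (B + 1) + |(a : ℝ)|⌉ with hH
  have hint : ∀ x : ℤ, |(x : ℝ)| ≤ κ * (B + 1) + |(a : ℝ)| → |x| ≤ H := fun x hx => by
    have : ((|x| : ℤ) : ℝ) ≤ H := by
      push_cast
      exact hx.trans (Int.le_ceil _)
    exact_mod_cast this
  -- Successive digit polynomials have degree below `n` and overlap after shifting; collecting their
  -- `j`-th coefficients in `c j` limits the total height to `n * H`.
  have key : ∀ (k : ℕ) (q : ℤ[X]), q.natDegree < n → (∀ z ∈ s, ‖aeval z q‖ ≤ B + 1 + k) →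
      ∃ c : ℕ → ℤ[X], (∀ j, HeightLE H (c j)) ∧
        p ∣ q - ∑ j ∈ Finset.range n, X ^ j * c j := by
    intro k
    induction k with
    | zero =>
      intro q hq hqs
      refine ⟨fun j => C (q.coeff j), fun j => HeightLE.const (hint _ ?_), ?_⟩
      · refine (hκ q hq (B + 1) (by positivity) (by simpa using hqs) j).trans ?_
        simp
      · have : q = ∑ j ∈ Finset.range n, X ^ j * C (q.coeff j) := by
          conv_lhs => rw [q.as_sum_range' n hq]
          exact Finset.sum_congr rfl fun j _ => by rw [← C_mul_X_pow_eq_monomial, mul_comm]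
        rw [← this, sub_self]
        exact dvd_zero p
    | succ k ih =>
      intro q hq hqs
      have hN : (0 : ℝ) < B + 1 + (k + 1 : ℕ) := by positivity
      set N : ℝ := B + 1 + (k + 1 : ℕ) with hNdef
      set t : ℝ := (B + 1) / N with ht
      have htN : t * N = B + 1 := div_mul_cancel₀ _ hN.ne'
      have ht0 : 0 ≤ t := by positivity
      have ht1 : t ≤ 1 := by
        rw [ht, div_le_one hN, hNdef]
        exact le_add_of_nonneg_right (Nat.cast_nonneg _)
      -- `e j` approximates `t * q.coeff j` within its class modulo `a`, so `q - d` is divisible by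
      -- `X` modulo `p`; as `t * N = B + 1`, its size does not depend on `k`.
      let e : ℕ → ℤ := fun j => q.coeff j - a * round ((1 - t) * q.coeff j / a)
      have he : ∀ j, |t * q.coeff j - e j| ≤ |(a : ℝ)| := fun j => by
        have h1 : t * q.coeff j - e j =
            -(a * ((1 - t) * q.coeff j / a - round ((1 - t) * q.coeff j / (a : ℝ)))) := by
          simp only [e]; push_cast; field_simp; ring
        rw [h1, abs_neg, abs_mul]
        refine mul_le_of_le_one_right (abs_nonneg _) ((abs_sub_round _).trans (by norm_num))
      have heH : ∀ j, |e j| ≤ H := fun j => hint _ <| by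
        have h1 := hκ q hq N hN.le hqs j
        have h2 : |t * (q.coeff j : ℝ)| ≤ κ * (B + 1) := by
          rw [abs_mul, abs_of_nonneg ht0, ← htN]
          nlinarith
        have h3 := abs_sub_abs_le_abs_sub (e j : ℝ) (t * q.coeff j)
        have h4 := he j
        rw [abs_sub_comm] at h4
        linarith
      let d : ℤ[X] := ∑ j ∈ Finset.range n, C (e j) * X ^ j
      have hdc : ∀ j, d.coeff j = if j < n then e j else 0 := fun j => by
        simp [d, coeff_X_pow]
      have hd : d.natDegree < n := by
        refine (natDegree_le_iff_coeff_eq_zero (n := n - 1)).2 (fun j hj => ?_) |>.trans_lt (by omega)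
        rw [hdc, if_neg (by omega)]
      obtain ⟨q', ⟨u, hu⟩, hq'⟩ := exists_shift (p := p) (q := q) (d := d) (by
        rw [coeff_sub, hdc, if_pos hn]
        simp [e, ← ha_def])
      obtain ⟨c, hc, v, hv⟩ := ih q' (by omega) fun z hz => by
        have h1 : aeval z q - (aeval z d + z * aeval z q') = 0 := by
          simpa [hroot z hz] using congrArg (aeval z) hu
        have h2 : z * aeval z q' = (1 - t : ℝ) * aeval z q +
            ∑ j ∈ Finset.range n, ((t * q.coeff j - e j : ℝ) : ℂ) * z ^ j := by
          have h3 : aeval z q = ∑ j ∈ Finset.range n, (q.coeff j : ℂ) * z ^ j := by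
            simp [aeval_eq_sum_range' hq]
          have h4 : aeval z d = ∑ j ∈ Finset.range n, (e j : ℂ) * z ^ j := by
            simp [d]
          have h5 : ∑ j ∈ Finset.range n, ((t * q.coeff j - e j : ℝ) : ℂ) * z ^ j =
              t * aeval z q - aeval z d := by
            rw [h3, h4, Finset.mul_sum, ← Finset.sum_sub_distrib]
            exact Finset.sum_congr rfl fun j _ => by push_cast; ring
          rw [h5]
          push_cast
          linear_combination -h1
        -- The bound drops from `N` to `(1 - t) * N + B = N - 1`; only `‖z‖ ≥ 1` is needed, so roots
        -- on the unit circle are allowed.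
        calc ‖aeval z q'‖ ≤ ‖z‖ * ‖aeval z q'‖ :=
              le_mul_of_one_le_left (norm_nonneg _) (hnorm z hz)
          _ = ‖z * aeval z q'‖ := (norm_mul _ _).symm
          _ ≤ (1 - t) * N + B := by
            rw [h2]
            refine (norm_add_le _ _).trans (add_le_add ?_ ((norm_sum_le _ _).trans ?_))
            · rw [norm_mul, Complex.norm_of_nonneg (by linarith)]
              exact mul_le_mul_of_nonneg_left (hqs z hz) (by linarith)
            · refine (Finset.sum_le_sum fun j _ => ?_).trans (hB z hz)
              rw [norm_mul, norm_pow, Complex.norm_real]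
              exact mul_le_mul_of_nonneg_right (he j) (by positivity)
          _ = B + 1 + k := by
            rw [sub_mul, htN, hNdef]; push_cast; ring
      refine ⟨fun j => C (e j) + X * c j, fun j => HeightLE.C_add_X_mul (heH j) (hc j),
        u + X * v, ?_⟩
      have h1 : ∑ j ∈ Finset.range n, X ^ j * (C (e j) + X * c j) =
          d + X * ∑ j ∈ Finset.range n, X ^ j * c j := by
        rw [Finset.mul_sum, ← Finset.sum_add_distrib]
        exact Finset.sum_congr rfl fun j _ => by ring
      rw [h1]
      linear_combination hu + X * hv
  refine ⟨n * H, fun q hq => ?_⟩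
  obtain ⟨k, hk⟩ := exists_nat_ge (∑ z ∈ s, ‖aeval z q‖)
  obtain ⟨c, hc, hdvd⟩ := key k q hq fun z hz => by
    have := Finset.single_le_sum (f := fun z : ℂ => ‖aeval z q‖) (fun _ _ => norm_nonneg _) hz
    linarith
  refine ⟨_, hdvd, ?_⟩
  simpa using HeightLE.sum (Finset.range n) fun j _ => (hc j).X_pow_mul j

theorem of_distinct_roots {p : ℤ[X]} (h0 : p.coeff 0 ≠ 0) (hn : 0 < p.natDegree)
    (s : Finset ℂ) (hs : p.natDegree ≤ s.card) (hroot : ∀ z ∈ s, aeval z p = 0)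
    (hnorm : ∀ z ∈ s, 1 ≤ ‖z‖) : HasBoundedRepresentatives p := by
  obtain ⟨C, hC⟩ := exists_norm_reduction h0 hn s hs hroot hnorm
  refine ⟨|p.coeff 0| + C, fun q => ?_⟩
  obtain ⟨f, g, m, ⟨u, hu⟩, hf, hg⟩ := exists_degree_reduction h0 hn _ q le_rfl
  obtain ⟨r, ⟨v, hv⟩, hr⟩ := hC g hg
  exact ⟨f + X ^ m * r, ⟨u + X ^ m * v, by linear_combination hu + X ^ m * hv⟩,
    hf.add (hr.X_pow_mul m)⟩

/-- By Gauss's lemma `p` stays irreducible over `ℚ`, hence separable, so it has as many complex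
roots as its degree. -/
theorem of_irreducible {p : ℤ[X]} (hp : Irreducible p)
    (hroots : ∀ z : ℂ, aeval z p = 0 → 1 ≤ ‖z‖) : HasBoundedRepresentatives p := by
  rcases Nat.eq_zero_or_pos p.natDegree with hn | hn
  · rw [eq_C_of_natDegree_eq_zero hn]
    refine C_of_ne_zero fun h => hp.ne_zero ?_
    rw [eq_C_of_natDegree_eq_zero hn, h, C_0]
  have h0 : p.coeff 0 ≠ 0 := fun h => by
    have := hroots 0 (by rw [← coeff_zero_eq_aeval_zero', h, map_zero])
    norm_num at this
  have hirr : Irreducible (p.map (Int.castRingHom ℚ)) :=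
    (IsPrimitive.Int.irreducible_iff_irreducible_map_cast (hp.isPrimitive hn.ne')).1 hp
  have hdeg : (p.map (Int.castRingHom ℚ)).natDegree = p.natDegree :=
    natDegree_map_eq_of_injective (RingHom.injective_int _) p
  have hroot : ∀ z ∈ (p.map (Int.castRingHom ℚ)).rootSet ℂ, aeval z p = 0 := fun z hz => by
    have := aeval_eq_zero_of_mem_rootSet hz
    rwa [← algebraMap_int_eq, aeval_map_algebraMap] at this
  refine of_distinct_roots h0 hn ((p.map (Int.castRingHom ℚ)).rootSet ℂ).toFinset ?_
    (fun z hz => hroot z (by simpa only [Set.mem_toFinset] using hz))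
    (fun z hz => hroots z (hroot z (by simpa only [Set.mem_toFinset] using hz)))
  rw [Set.toFinset_card, card_rootSet_eq_natDegree hirr.separable (IsAlgClosed.splits _), hdeg]

theorem of_roots {p : ℤ[X]} (hp : p ≠ 0) (hroots : ∀ z : ℂ, aeval z p = 0 → 1 ≤ ‖z‖) :
    HasBoundedRepresentatives p := by
  induction p using UniqueFactorizationMonoid.induction_on_prime with
  | h₁ => exact absurd rfl hp
  | h₂ u hu => exact of_isUnit hu
  | h₃ f q hf hq ih =>
    exact (of_irreducible hq.irreducible fun z hz => hroots z (by simp [hz])).mul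
      (ih hf fun z hz => hroots z (by simp [hz]))

end HasBoundedRepresentatives

/-! ### From polynomials to digit expansions -/

variable {d : ℕ} (A : Matrix (Fin d) (Fin d) ℚ)

theorem isComplexEigenvalue_iff (z : ℂ) :
    IsComplexEigenvalue A z ↔ aeval z A.charpoly = 0 := by
  rw [IsComplexEigenvalue, Module.End.hasEigenvalue_iff_isRoot_charpoly,
    Matrix.charpoly_toLin', Matrix.charpoly_map, IsRoot.def, eval_map_algebraMap]

theorem exists_intPolynomial : ∃ p : ℤ[X], p ≠ 0 ∧ aeval A p = 0 ∧
    ∀ z : ℂ, aeval z p = 0 → IsComplexEigenvalue A z := by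
  obtain ⟨b, hb0, hb⟩ :=
    IsLocalization.integerNormalization_spec (nonZeroDivisors ℤ) A.charpoly
  have hb0 : b ≠ 0 := nonZeroDivisors.ne_zero hb0
  refine ⟨IsLocalization.integerNormalization (nonZeroDivisors ℤ) A.charpoly, ?_, ?_,
    fun z hz => ?_⟩
  · rw [Ne, IsLocalization.integerNormalization_eq_zero_iff le_rfl]
    exact A.charpoly_monic.ne_zero
  · rw [← aeval_map_algebraMap ℚ, hb, map_zsmul, Matrix.aeval_self_charpoly, smul_zero]
  · rw [isComplexEigenvalue_iff]
    rw [← aeval_map_algebraMap ℚ, hb, map_zsmul] at hz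
    exact (smul_eq_zero.1 hz).resolve_left hb0

theorem radixSet_mono {S T : Set (Fin d → ℚ)} (h : S ⊆ T) : radixSet A S ⊆ radixSet A T := by
  rintro x ⟨l, hl, s, hs, rfl⟩
  exact ⟨l, hl, s, fun i => h (hs i), rfl⟩

theorem subset_radixSet (S : Set (Fin d → ℚ)) : S ⊆ radixSet A S := fun x hx =>
  ⟨1, le_rfl, fun _ => x, fun _ => hx, by simp⟩

theorem sum_mulVec_eq_sum_aeval_mulVec_single {l : ℕ} (f : Fin d → ℤ[X])
    (hf : ∀ j, (f j).natDegree < l) :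
    ∑ i : Fin l, (A ^ (i : ℕ)).mulVec (fun j => ((f j).coeff i : ℚ)) =
      ∑ j, (aeval A (f j)).mulVec (Pi.single j 1) := by
  have h1 : ∀ j, (aeval A (f j)).mulVec (Pi.single j 1) =
      ∑ i : Fin l, (A ^ (i : ℕ)).mulVec (Pi.single j ((f j).coeff i : ℚ)) := fun j => by
    rw [aeval_eq_sum_range' (hf j), Finset.sum_range, Matrix.sum_mulVec]
    refine Finset.sum_congr rfl fun i _ => ?_
    rw [← Int.cast_smul_eq_zsmul ℚ, Matrix.smul_mulVec, ← Matrix.mulVec_smul, ← Pi.single_smul,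
      smul_eq_mul, mul_one]
  simp_rw [h1]
  rw [Finset.sum_comm]
  refine Finset.sum_congr rfl fun i _ => ?_
  rw [← Matrix.mulVec_sum, Finset.univ_sum_single]

theorem exists_digits (h : ¬ ∃ lam : ℂ, IsComplexEigenvalue A lam ∧ ‖lam‖ < 1) :
    ∃ D : Set (Fin d → ℚ), D ⊆ intVectors d ∧ IsDigitSystem A D ∧ HasFinitenessProperty A D := by
  obtain ⟨p, hp0, hpA, hp⟩ := exists_intPolynomial A
  obtain ⟨C, hC⟩ := HasBoundedRepresentatives.of_roots hp0 fun z hz =>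
    not_lt.1 fun hlt => h ⟨z, hp z hz, hlt⟩
  let D : Set (Fin d → ℚ) := (fun (z : Fin d → ℤ) i => (z i : ℚ)) '' Set.Icc (fun _ => -C) fun _ => C
  have hD : D ⊆ intVectors d := Set.image_subset_range _ _
  refine ⟨D, hD, ⟨(Set.finite_Icc _ _).image _, hD.trans (subset_radixSet A _)⟩,
    Set.Subset.antisymm ?_ (radixSet_mono A hD)⟩
  rintro x ⟨l, hl, s, hs, rfl⟩
  choose z hz using hs
  let f : Fin d → ℤ[X] := fun j => ∑ i : Fin l, monomial (i : ℕ) (z i j)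
  have hfc : ∀ j (i : Fin l), (f j).coeff i = z i j := fun j i => by
    simp [f, coeff_monomial, Fin.val_inj]
  have hf : ∀ j, (f j).natDegree < l := fun j => by
    refine (natDegree_sum_le_of_forall_le (n := l - 1) _ _ fun i _ => ?_).trans_lt (by omega)
    exact (natDegree_monomial_le _).trans (by omega)
  choose r hr hrC using fun j => hC (f j)
  have hrA : ∀ j, aeval A (f j) = aeval A (r j) := fun j => by
    obtain ⟨u, hu⟩ := hr j
    rw [← sub_eq_zero, ← map_sub, hu, map_mul, hpA, zero_mul]
  -- A common length exceeding every degree, and at least 1 even for `d = 0`.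
  refine ⟨(∑ j, (r j).natDegree) + 1, by omega, fun i j => ((r j).coeff i : ℚ), fun i =>
    ⟨fun j => (r j).coeff i, ⟨fun j => (abs_le.1 (hrC j i)).1, fun j => (abs_le.1 (hrC j i)).2⟩,
      rfl⟩, ?_⟩
  rw [sum_mulVec_eq_sum_aeval_mulVec_single A r fun j => Nat.lt_succ_of_le <|
    Finset.single_le_sum (f := fun j => (r j).natDegree) (fun _ _ => Nat.zero_le _)
      (Finset.mem_univ j)]
  simp_rw [← hrA]
  rw [← sum_mulVec_eq_sum_aeval_mulVec_single A f hf]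
  refine Finset.sum_congr rfl fun i _ => ?_
  simp_rw [hfc, ← hz]

/-! ### Eigenvalues inside the unit disc -/

theorem exists_left_eigenvector {z : ℂ} (hz : IsComplexEigenvalue A z) :
    ∃ w : Fin d → ℂ, w ≠ 0 ∧
      Matrix.vecMul w (A.map (algebraMap ℚ ℂ)) = z • w := by
  have hdet : (Matrix.scalar (Fin d) z - A.map (algebraMap ℚ ℂ)).det = 0 := by
    rw [← Matrix.eval_charpoly, Matrix.charpoly_map, eval_map_algebraMap]
    exact (isComplexEigenvalue_iff A z).1 hz
  obtain ⟨w, hw0, hw⟩ := Matrix.exists_vecMul_eq_zero_iff.2 hdet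
  refine ⟨w, hw0, ?_⟩
  rw [Matrix.vecMul_sub, sub_eq_zero] at hw
  rw [← hw]
  ext i
  simp [Matrix.scalar_apply, Matrix.vecMul_diagonal, mul_comm]

/-- A left eigenvector for an eigenvalue inside the unit disc is bounded on `D[A]`. -/
theorem exists_dotProduct_le {D : Set (Fin d → ℚ)} (hD : D.Finite) {z : ℂ} (hz : ‖z‖ < 1)
    {w : Fin d → ℂ} (hw : Matrix.vecMul w (A.map (algebraMap ℚ ℂ)) = z • w) :
    ∃ C : ℝ, ∀ x ∈ radixSet A D, ‖w ⬝ᵥ fun j => (x j : ℂ)‖ ≤ C := by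
  let φ : (Fin d → ℚ) →+ ℂ :=
    { toFun := fun x => w ⬝ᵥ fun j => (x j : ℂ)
      map_zero' := by simp [dotProduct]
      map_add' := fun x y => by simp [dotProduct, mul_add, Finset.sum_add_distrib] }
  have hφA : ∀ x, φ (A.mulVec x) = z * φ x := fun x => by
    have h1 : (fun j => ((A.mulVec x j : ℚ) : ℂ)) =
        (A.map (algebraMap ℚ ℂ)).mulVec fun j => (x j : ℂ) := by
      ext j; simp [Matrix.mulVec, dotProduct]
    change (w ⬝ᵥ fun j => ((A.mulVec x j : ℚ) : ℂ)) = z * (w ⬝ᵥ fun j => (x j : ℂ))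
    rw [h1, Matrix.dotProduct_mulVec, hw, smul_dotProduct, smul_eq_mul]
  have hφ : ∀ (i : ℕ) x, φ ((A ^ i).mulVec x) = z ^ i * φ x := fun i => by
    induction i with
    | zero => simp
    | succ i ih =>
      intro x
      rw [pow_succ, ← Matrix.mulVec_mulVec, ih, hφA, pow_succ, mul_assoc]
  obtain ⟨B, hB⟩ := (hD.image fun x => ‖φ x‖).bddAbove
  refine ⟨max B 0 * (1 - ‖z‖)⁻¹, ?_⟩
  rintro x ⟨l, -, s, hs, rfl⟩
  change ‖φ _‖ ≤ _
  rw [map_sum]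
  calc ‖∑ i : Fin l, φ ((A ^ (i : ℕ)).mulVec (s i))‖
      ≤ ∑ i : Fin l, max B 0 * ‖z‖ ^ (i : ℕ) := by
        refine norm_sum_le_of_le _ fun i _ => ?_
        rw [hφ, norm_mul, norm_pow, mul_comm]
        exact mul_le_mul_of_nonneg_right (le_max_of_le_left (hB ⟨_, hs i, rfl⟩)) (by positivity)
    _ = max B 0 * ∑ i ∈ Finset.range l, ‖z‖ ^ i := by rw [Finset.mul_sum, Finset.sum_range]
    _ ≤ max B 0 * (1 - ‖z‖)⁻¹ := by
        refine mul_le_mul_of_nonneg_left ?_ (le_max_right _ _)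
        rw [← tsum_geometric_of_lt_one (norm_nonneg z) hz]
        exact (summable_geometric_of_lt_one (norm_nonneg z) hz).sum_le_tsum _
          fun _ _ => by positivity

theorem not_exists_eigenvalue_lt_one {D : Set (Fin d → ℚ)} (hD : IsDigitSystem A D)
    (hfin : HasFinitenessProperty A D) :
    ¬ ∃ lam : ℂ, IsComplexEigenvalue A lam ∧ ‖lam‖ < 1 := by
  rintro ⟨z, hz, hlt⟩
  obtain ⟨w, hw0, hw⟩ := exists_left_eigenvector A hz
  obtain ⟨C, hC⟩ := exists_dotProduct_le A hD.1 hlt hw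
  rw [← hfin] at hC
  obtain ⟨j, hj⟩ := Function.ne_iff.1 hw0
  have hj' : 0 < ‖w j‖ := norm_pos_iff.2 hj
  -- The integer vector `n eⱼ` has value `n * w j`, which exceeds the bound `C` in norm.
  obtain ⟨n, hn⟩ := exists_nat_gt (C / ‖w j‖)
  have h1 := hC (Pi.single j (n : ℚ)) (subset_radixSet A _ ⟨Pi.single j (n : ℤ), by
    ext i; by_cases h : i = j
    · subst h; simp
    · simp [h]⟩)
  have h2 : (fun i => ((Pi.single j (n : ℚ) : Fin d → ℚ) i : ℂ)) = Pi.single j (n : ℂ) := by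
    ext i; by_cases h : i = j
    · subst h; simp
    · simp [h]
  rw [h2, dotProduct_single, norm_mul, Complex.norm_natCast] at h1
  rw [div_lt_iff₀ hj'] at hn
  linarith

end MatrixDigit

theorem theorem5p1 (d : ℕ) (A : Matrix (Fin d) (Fin d) ℚ) :
    ((∃ D : Set (Fin d → ℚ),
        MatrixDigit.IsDigitSystem A D ∧ MatrixDigit.HasFinitenessProperty A D) ↔
      ¬ ∃ lam : ℂ, MatrixDigit.IsComplexEigenvalue A lam ∧ ‖lam‖ < 1) ∧
    ((¬ ∃ lam : ℂ, MatrixDigit.IsComplexEigenvalue A lam ∧ ‖lam‖ < 1) →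
      ∃ D : Set (Fin d → ℚ), D ⊆ MatrixDigit.intVectors d ∧
        MatrixDigit.IsDigitSystem A D ∧ MatrixDigit.HasFinitenessProperty A D) :=
  ⟨⟨fun ⟨_, hD, hfin⟩ => MatrixDigit.not_exists_eigenvalue_lt_one A hD hfin, fun h =>
    let ⟨D, _, hD⟩ := MatrixDigit.exists_digits A h
    ⟨D, hD⟩⟩, MatrixDigit.exists_digits A⟩
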